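/- Let $\Omega\subset\mathbb R^n$ be open, let $(X,d)$ be a complete metric space with a fixed point $z_0\in X$, and let $\nu\in\mathbb R^n\setminus\{0\}$. Let $\mathrm{Lip}_{z_0}(X)$ be the space of Lipschitz functions $\varphi\colon X\to\mathbb R$ with $\varphi(z_0)=0$, normed by $\mathrm{Lip}(\varphi)=\sup_{x\ne y}|\varphi(x)-\varphi(y)|/d(x,y)$, and let $\mathrm{Lip}_{z_0}(X)^*$ be its dual with the dual norm. Definitions. For $f\colon\Omega\to X$ and $x\in\Omega$ the metric directional derivative is $\mathrm m\partial_\nu f(x)=\lim_{h\to0}d(f(x+h\nu),f(x))/|h|$, if this limit exists in $[0,\infty)$. Suppose that there is $C>0$ with $$\limsup_{h\to0}\frac{|\varphi(f(x+h\nu))-\varphi(f(x))|}{|h|}\le C\,\mathrm{Lip}(\varphi)\quad\text{for all }\varphi\in\mathrm{Lip}_{z_0}(X).\qquad(*)$$ A functional $T\in\mathrm{Lip}_{z_0}(X)^*$ is then called a weak weak* derivative of $f$ at $x$ in direction $\nu$ if $T(\varphi)=\frac{\partial(\varphi\circ f)}{\partial\nu}(x)$ for every $\varphi\in\mathrm{Lip}_{z_0}(X)$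 for which this directional derivative exists, and $\|T\|\le C$ for every $C>0$ satisfying $(*)$. Given a Banach limit $\Phi$ (a continuous positive linear functional on $\ell^\infty$ that extends the limit of convergent sequences) and positive reals $\delta_k\to0$, define $\partial^\circ_\nu f(x)\in\mathrm{Lip}_{z_0}(X)^*$ at every $x$ where some $C>0$ satisfies $(*)$ by $$\langle\varphi,\partial^\circ_\nu f(x)\rangle=\Phi\text{-}\lim_{k\to\infty}\frac{\varphi(f(x+\delta_k\nu))-\varphi(f(x))}{\delta_k}$$ (the finitely many $k$ with $x+\delta_k\nu\notin\Omega$ do not affect the value). Theorem. Let $f\colon\Omega\to X$ be measurable (preimages of Borel sets are Lebesgue measurable) and essentially separably valued ($f(\Omega\setminus\Sigma)$ is separable for some Lebesgue null set $\Sigma\subset\Omega$). Suppose that $f$ is absolutely continuous on almost every compact line segment contained in $\Omega$ and parallel to $\nu$, i.e. there is a family $L$ of lines parallel to $\nu$ covering almost all of $\Omega$ such that for every $l\in L$ the map $f$ is absolutely continuous on each compact segment contained in $l\cap\Omega$. Assume also that $\mathrm m\partial_\nu f\in L^1_{\mathrm{loc}}(\Omega)$. Then: 1. For every choice of $\Phi$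 and $(\delta_k)$, for almost every $x\in\Omega$ the functional $\partial^\circ_\nu f(x)$ is defined and is a weak weak* derivative of $f$ at $x$ in direction $\nu$, $\mathrm m\partial_\nu f(x)$ exists, and $$\|\partial^\circ_\nu f(x)\|_{\mathrm{Lip}_{z_0}(X)^*}=\mathrm m\partial_\nu f(x).$$ In particular $x\mapsto\|\partial^\circ_\nu f(x)\|$ is Lebesgue measurable on $\Omega$. 2. More generally, if $D(x)\in\mathrm{Lip}_{z_0}(X)^*$ is, for almost every $x\in\Omega$, a weak weak* derivative of $f$ at $x$ in direction $\nu$, then $\|D(x)\|=\mathrm m\partial_\nu f(x)$ for almost every $x\in\Omega$, and $x\mapsto\|D(x)\|$ is Lebesgue measurable on $\Omega$. -/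

import Mathlib

open MeasureTheory Filter Topology Set
open scoped ENNReal NNReal

noncomputable section

/-! ### The space of Lipschitz functions vanishing at the base point -/

/-- Real valued Lipschitz functions on `X` vanishing at `z₀`, as a submodule of all functions. -/
def lipZeroSubmodule (X : Type*) [MetricSpace X] (z₀ : X) : Submodule ℝ (X → ℝ) where
  carrier := {φ | (∃ K : ℝ≥0, LipschitzWith K φ) ∧ φ z₀ = 0}
  zero_mem' := ⟨⟨0, LipschitzWith.const 0⟩, rfl⟩
  add_mem' := by
    rintro φ ψ ⟨⟨K, hK⟩, hφ⟩ ⟨⟨K', hK'⟩, hψ⟩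
    exact ⟨⟨K + K', hK.add hK'⟩, by simp [hφ, hψ]⟩
  smul_mem' := by
    rintro c φ ⟨⟨K, hK⟩, hφ⟩
    exact ⟨⟨‖c‖₊ * K, (lipschitzWith_smul c).comp hK⟩, by simp [hφ]⟩

/-- The space `Lip_{z₀}(X)`. It is a type of its own, so that it does not inherit the topology
of pointwise convergence from `X → ℝ`; its norm is defined below. -/
def LipZero (X : Type*) [MetricSpace X] (z₀ : X) : Type _ := lipZeroSubmodule X z₀

namespace LipZero

variable {X : Type*} [MetricSpace X] {z₀ : X}

instance : AddCommGroup (LipZero X z₀) := inferInstanceAs (AddCommGroup (lipZeroSubmodule X z₀))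

instance : Module ℝ (LipZero X z₀) := inferInstanceAs (Module ℝ (lipZeroSubmodule X z₀))

instance : CoeFun (LipZero X z₀) (fun _ => X → ℝ) := ⟨fun φ => φ.1⟩

theorem add_apply (φ ψ : LipZero X z₀) (x : X) : (φ + ψ) x = φ x + ψ x := rfl

theorem smul_apply (c : ℝ) (φ : LipZero X z₀) (x : X) : (c • φ) x = c * φ x := rfl

/-- The norm `Lip(φ) = sup {|φ(x) - φ(y)| / d(x, y) : x ≠ y}`. -/
instance : Norm (LipZero X z₀) :=
  ⟨fun φ => sSup {r : ℝ | ∃ x y : X, x ≠ y ∧ r = |φ x - φ y| / dist x y}⟩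

theorem norm_def (φ : LipZero X z₀) :
    ‖φ‖ = sSup {r : ℝ | ∃ x y : X, x ≠ y ∧ r = |φ x - φ y| / dist x y} := rfl

theorem norm_nonneg' (φ : LipZero X z₀) : 0 ≤ ‖φ‖ := by
  rw [norm_def]
  apply Real.sSup_nonneg
  rintro r ⟨x, y, -, rfl⟩
  positivity

theorem abs_sub_le (φ : LipZero X z₀) (x y : X) : |φ x - φ y| ≤ ‖φ‖ * dist x y := by
  rcases eq_or_ne x y with rfl | hxy
  · simp
  · obtain ⟨⟨K, hK⟩, -⟩ := φ.2
    have hb : BddAbove {r : ℝ | ∃ x y : X, x ≠ y ∧ r = |φ x - φ y| / dist x y} := by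
      refine ⟨K, ?_⟩
      rintro r ⟨u, v, huv, rfl⟩
      rw [div_le_iff₀ (dist_pos.2 huv), ← Real.dist_eq]
      exact hK.dist_le_mul u v
    rw [← div_le_iff₀ (dist_pos.2 hxy), norm_def]
    exact le_csSup hb ⟨x, y, hxy, rfl⟩

theorem norm_le_of_abs_sub_le (φ : LipZero X z₀) {C : ℝ} (hC : 0 ≤ C)
    (h : ∀ x y, |φ x - φ y| ≤ C * dist x y) : ‖φ‖ ≤ C := by
  rw [norm_def]
  refine Real.sSup_le ?_ hC
  rintro r ⟨x, y, hxy, rfl⟩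
  rw [div_le_iff₀ (dist_pos.2 hxy)]
  exact h x y

theorem norm_smul_le' (c : ℝ) (φ : LipZero X z₀) : ‖c • φ‖ ≤ |c| * ‖φ‖ := by
  refine norm_le_of_abs_sub_le _ (mul_nonneg (abs_nonneg c) (norm_nonneg' φ)) fun x y => ?_
  rw [smul_apply, smul_apply, ← mul_sub, abs_mul, mul_assoc]
  exact mul_le_mul_of_nonneg_left (abs_sub_le φ x y) (abs_nonneg c)

theorem core : NormedSpace.Core ℝ (LipZero X z₀) where
  norm_nonneg := norm_nonneg'
  norm_smul c φ := by
    rw [Real.norm_eq_abs]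
    apply le_antisymm (norm_smul_le' c φ)
    rcases eq_or_ne c 0 with rfl | hc
    · simpa using norm_nonneg' _
    · have h := norm_smul_le' c⁻¹ (c • φ)
      rw [smul_smul, inv_mul_cancel₀ hc, one_smul, abs_inv] at h
      calc |c| * ‖φ‖ ≤ |c| * (|c|⁻¹ * ‖c • φ‖) := mul_le_mul_of_nonneg_left h (abs_nonneg c)
        _ = ‖c • φ‖ := by rw [← mul_assoc, mul_inv_cancel₀ (abs_ne_zero.2 hc), one_mul]
  norm_triangle φ ψ := by
    refine norm_le_of_abs_sub_le _ (add_nonneg (norm_nonneg' φ) (norm_nonneg' ψ)) fun x y => ?_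
    have h1 := abs_sub_le φ x y
    have h2 := abs_sub_le ψ x y
    rw [add_apply, add_apply, add_sub_add_comm, add_mul]
    exact (abs_add_le _ _).trans (add_le_add h1 h2)
  norm_eq_zero_iff φ := by
    constructor
    · intro h
      apply Subtype.ext
      funext x
      have h1 := abs_sub_le φ x z₀
      have h2 : φ z₀ = 0 := φ.2.2
      rw [h, zero_mul, h2, sub_zero] at h1
      exact abs_eq_zero.1 (le_antisymm h1 (abs_nonneg _))
    · rintro rfl
      apply le_antisymm _ (norm_nonneg' _)
      refine norm_le_of_abs_sub_le _ le_rfl fun x y => ?_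
      have h0 : ∀ z, (0 : LipZero X z₀) z = 0 := fun _ => rfl
      simp [h0]

instance : NormedAddCommGroup (LipZero X z₀) := NormedAddCommGroup.ofCore core

instance : NormedSpace ℝ (LipZero X z₀) := NormedSpace.ofCore core

end LipZero

/-! ### Maps on domains of Euclidean space

A map `f : Ω → X` is represented by a map on all of `ℝⁿ`; only its values on the open set `Ω`
matter below. -/

section Maps

variable {n : ℕ} {X : Type*} [MetricSpace X]

/-- There is a Lebesgue null set `S ⊆ Ω` such that `f(Ω \ S)` is separable. -/
def EssSeparablyValued (f : EuclideanSpace ℝ (Fin n) → X) (Ω : Set (EuclideanSpace ℝ (Fin n))) :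
    Prop :=
  ∃ S ⊆ Ω, volume S = 0 ∧ TopologicalSpace.IsSeparable (f '' (Ω \ S))

/-- The line through `p` in direction `ν`. -/
def lineThrough (ν p : EuclideanSpace ℝ (Fin n)) : Set (EuclideanSpace ℝ (Fin n)) :=
  range fun t : ℝ => p + t • ν

/-- `f` is absolutely continuous on almost every compact line segment in `Ω` parallel to `ν`:
there is a family `L` of lines parallel to `ν` which covers almost all of `Ω`, such that on every
line `l ∈ L`, the map `f` is absolutely continuous on each compact segment contained in
`l ∩ Ω`. -/
def ACOnAlmostEveryLine (f : EuclideanSpace ℝ (Fin n) → X)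
    (Ω : Set (EuclideanSpace ℝ (Fin n))) (ν : EuclideanSpace ℝ (Fin n)) : Prop :=
  ∃ L : Set (Set (EuclideanSpace ℝ (Fin n))),
    (∀ l ∈ L, ∃ p, l = lineThrough ν p) ∧ volume (Ω \ ⋃₀ L) = 0 ∧
    ∀ l ∈ L, ∀ p ∈ l, ∀ a b : ℝ, a ≤ b → (∀ t ∈ Icc a b, p + t • ν ∈ Ω) →
      AbsolutelyContinuousOnInterval (fun t : ℝ => f (p + t • ν)) a b

/-- `f` has metric directional derivative `m` at `x` in direction `ν`:
`m = lim_{h → 0} d(f(x + hν), f(x)) / |h|`. -/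
def HasMetricDirDeriv (f : EuclideanSpace ℝ (Fin n) → X) (ν x : EuclideanSpace ℝ (Fin n))
    (m : ℝ) : Prop :=
  Tendsto (fun h : ℝ => dist (f (x + h • ν)) (f x) / |h|) (𝓝[≠] 0) (𝓝 m)

open Classical in
/-- The metric directional derivative; the value is `0` where it does not exist. -/
def metricDirDeriv (f : EuclideanSpace ℝ (Fin n) → X) (ν x : EuclideanSpace ℝ (Fin n)) : ℝ :=
  if h : ∃ m, HasMetricDirDeriv f ν x m then h.choose else 0

/-- `limsup_{h → 0} |φ(f(x + hν)) - φ(f(x))| / |h| ≤ C Lip(φ)` for all `φ ∈ Lip_{z₀}(X)`;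
the upper limit is taken in `[0, ∞]`. -/
def DirLipBound (z₀ : X) (f : EuclideanSpace ℝ (Fin n) → X) (ν x : EuclideanSpace ℝ (Fin n))
    (C : ℝ) : Prop :=
  ∀ φ : LipZero X z₀,
    limsup (fun h : ℝ => ENNReal.ofReal (|φ (f (x + h • ν)) - φ (f x)| / |h|)) (𝓝[≠] 0)
      ≤ ENNReal.ofReal (C * ‖φ‖)

/-- `T ∈ Lip_{z₀}(X)*` is a weak weak* derivative of `f` at `x` in direction `ν`: some bound
`C > 0` as above exists, `T` maps each `φ` to the classical directional derivative of `φ ∘ f`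
at `x` whenever the latter exists, and `‖T‖ ≤ C` for every such bound `C`. -/
structure IsWeakWeakStarDirDeriv {z₀ : X} (f : EuclideanSpace ℝ (Fin n) → X)
    (ν x : EuclideanSpace ℝ (Fin n)) (T : StrongDual ℝ (LipZero X z₀)) : Prop where
  exists_bound : ∃ C > 0, DirLipBound z₀ f ν x C
  apply_eq : ∀ (φ : LipZero X z₀) (c : ℝ), HasLineDerivAt ℝ (fun y => φ (f y)) c x ν → T φ = c
  norm_le : ∀ C > 0, DirLipBound z₀ f ν x C → ‖T‖ ≤ C

end Maps

/-! ### The weak weak* derivative defined through a Banach limit -/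

/-- A Banach limit: a positive continuous linear functional on `ℓ^∞` extending the limit. -/
structure BanachLimit where
  toFun : StrongDual ℝ (lp (fun _ : ℕ => ℝ) ∞)
  eq_of_tendsto : ∀ (a : lp (fun _ : ℕ => ℝ) ∞) (l : ℝ),
    Tendsto (fun k => a k) atTop (𝓝 l) → toFun a = l
  nonneg : ∀ a : lp (fun _ : ℕ => ℝ) ∞, (∀ k, 0 ≤ a k) → 0 ≤ toFun a

namespace BanachLimit

theorem le_of_eventually_le (Φ : BanachLimit) (a : lp (fun _ : ℕ => ℝ) ∞) (c : ℝ)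
    (h : ∀ᶠ k in atTop, a k ≤ c) : Φ.toFun a ≤ c := by
  have hbd : BddAbove (range fun k => ‖max (a k - c) 0‖) := by
    refine ⟨‖a‖ + |c|, ?_⟩
    rintro _ ⟨k, rfl⟩
    have h1 : |a k| ≤ ‖a‖ := lp.norm_apply_le_norm (by simp) a k
    change ‖max (a k - c) 0‖ ≤ _
    rw [Real.norm_eq_abs, abs_of_nonneg (le_max_right _ _)]
    apply max_le
    · linarith [le_abs_self (a k), neg_abs_le c]
    · positivity
  have hc : BddAbove (range fun _ : ℕ => ‖c‖) := ⟨‖c‖, by rintro _ ⟨k, rfl⟩; exact le_rfl⟩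
  let e : lp (fun _ : ℕ => ℝ) ∞ := ⟨fun k => max (a k - c) 0, memℓp_infty hbd⟩
  let cc : lp (fun _ : ℕ => ℝ) ∞ := ⟨fun _ => c, memℓp_infty hc⟩
  have he : Φ.toFun e = 0 := by
    apply Φ.eq_of_tendsto
    apply tendsto_const_nhds.congr'
    filter_upwards [h] with k hk
    exact (max_eq_right (by linarith)).symm
  have hcc : Φ.toFun cc = c := Φ.eq_of_tendsto cc c tendsto_const_nhds
  have hpos : 0 ≤ Φ.toFun (cc + e - a) := by
    apply Φ.nonneg
    intro k
    have h2 : (cc + e - a) k = c + max (a k - c) 0 - a k := rfl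
    rw [h2]
    linarith [le_max_left (a k - c) 0]
  rw [map_sub, map_add, he, hcc] at hpos
  linarith

end BanachLimit

section Construction

variable {n : ℕ} {X : Type*} [MetricSpace X] {z₀ : X}

/-- The difference quotients `(φ(f(x + δ_k ν)) - φ(f(x))) / δ_k`. -/
def lipDiffQuot (δ : ℕ → ℝ) (f : EuclideanSpace ℝ (Fin n) → X)
    (ν x : EuclideanSpace ℝ (Fin n)) (φ : LipZero X z₀) (k : ℕ) : ℝ :=
  (φ (f (x + δ k • ν)) - φ (f x)) / δ k

variable {δ : ℕ → ℝ} {f : EuclideanSpace ℝ (Fin n) → X} {ν x : EuclideanSpace ℝ (Fin n)}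

theorem eventually_abs_lipDiffQuot_le (hpos : ∀ k, 0 < δ k) (hlim : Tendsto δ atTop (𝓝 0))
    {C : ℝ} (hC : 0 < C) (hb : DirLipBound z₀ f ν x C)
    (φ : LipZero X z₀) {ε : ℝ} (hε : 0 < ε) :
    ∀ᶠ k in atTop, |lipDiffQuot δ f ν x φ k| ≤ C * ‖φ‖ + ε := by
  have hn : 0 ≤ C * ‖φ‖ := mul_nonneg hC.le (norm_nonneg _)
  have h1 := eventually_lt_of_limsup_lt ((hb φ).trans_lt
    ((ENNReal.ofReal_lt_ofReal_iff (by linarith)).2 (lt_add_of_pos_right _ hε)))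
  have h2 : Tendsto δ atTop (𝓝[≠] 0) :=
    tendsto_nhdsWithin_iff.2 ⟨hlim, Eventually.of_forall fun k => (hpos k).ne'⟩
  filter_upwards [h2.eventually h1] with k hk
  rw [ENNReal.ofReal_lt_ofReal_iff (by linarith)] at hk
  rw [lipDiffQuot, abs_div]
  exact hk.le

theorem memℓp_lipDiffQuot (hpos : ∀ k, 0 < δ k) (hlim : Tendsto δ atTop (𝓝 0))
    (hb : ∃ C > 0, DirLipBound z₀ f ν x C) (φ : LipZero X z₀) :
    Memℓp (E := fun _ : ℕ => ℝ) (lipDiffQuot δ f ν x φ) ∞ := by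
  obtain ⟨C, hC, hb⟩ := hb
  apply memℓp_infty
  have h : ∀ᶠ k in atTop, ‖lipDiffQuot δ f ν x φ k‖ ≤ C * ‖φ‖ + 1 :=
    eventually_abs_lipDiffQuot_le hpos hlim hC hb φ one_pos
  exact (show IsBoundedUnder (· ≤ ·) atTop fun k => ‖lipDiffQuot δ f ν x φ k‖ from
    ⟨_, h⟩).bddAbove_range

end Construction

section Functional

variable {n : ℕ} {X : Type*} [MetricSpace X] {z₀ : X}

open Classical in
/-- The weak weak* derivative `∂°_ν f(x) ∈ Lip_{z₀}(X)*` obtained from the Banach limit `Φ` and the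
null sequence `δ`: it sends `φ` to `Φ-lim_k (φ(f(x + δ_k ν)) - φ(f(x))) / δ_k`. It is defined
at points where a bound `C` as in `DirLipBound` exists, and set to `0` elsewhere. -/
def weakWeakStarDirDeriv (Φ : BanachLimit) {δ : ℕ → ℝ} (hpos : ∀ k, 0 < δ k)
    (hlim : Tendsto δ atTop (𝓝 0)) (z₀ : X) (f : EuclideanSpace ℝ (Fin n) → X)
    (ν x : EuclideanSpace ℝ (Fin n)) : StrongDual ℝ (LipZero X z₀) :=
  if hb : ∃ C > 0, DirLipBound z₀ f ν x C then
    LinearMap.mkContinuousOfExistsBound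
      { toFun := fun φ => Φ.toFun ⟨lipDiffQuot δ f ν x φ, memℓp_lipDiffQuot hpos hlim hb φ⟩
        map_add' := fun φ ψ => by
          rw [← map_add]
          congr 1
          ext k
          change lipDiffQuot δ f ν x (φ + ψ) k = lipDiffQuot δ f ν x φ k + lipDiffQuot δ f ν x ψ k
          simp only [lipDiffQuot, LipZero.add_apply]
          ring
        map_smul' := fun c φ => by
          rw [RingHom.id_apply, ← map_smul]
          congr 1
          ext k
          change lipDiffQuot δ f ν x (c • φ) k = c * lipDiffQuot δ f ν x φ k
          simp only [lipDiffQuot, LipZero.smul_apply]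
          ring }
      (by
        obtain ⟨C, hC, hbC⟩ := hb
        refine ⟨C, fun φ => ?_⟩
        have key : ∀ ψ : LipZero X z₀, Φ.toFun ⟨lipDiffQuot δ f ν x ψ,
            memℓp_lipDiffQuot hpos hlim ⟨C, hC, hbC⟩ ψ⟩ ≤ C * ‖ψ‖ := by
          intro ψ
          refine le_of_forall_pos_le_add fun ε hε => Φ.le_of_eventually_le _ _ ?_
          filter_upwards [eventually_abs_lipDiffQuot_le hpos hlim hC hbC ψ hε] with k hk
          exact (le_abs_self _).trans hk
        refine abs_le'.2 ⟨key φ, ?_⟩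
        have h := key (-φ)
        rw [norm_neg] at h
        refine le_trans (le_of_eq ?_) h
        change -Φ.toFun _ = _
        rw [← map_neg]
        congr 1
        ext k
        change -lipDiffQuot δ f ν x φ k = lipDiffQuot δ f ν x (-φ) k
        have hneg : ∀ z, (-φ) z = -φ z := fun _ => rfl
        simp only [lipDiffQuot, hneg]
        ring)
  else 0

end Functional

end

/-! ### Curves described by countably many distances; rational parameters and measurability -/

section MetricCurves

variable {X : Type*} [MetricSpace X]

/-! Fix a sequence `d i` whose closure contains almost all values of `f`. Call `x` good if every
distance from `d i` to `f (x + h • ν)` is differentiable at `h = 0`, with derivative `c i`, and for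
each `ε` one of these distances captures the displacement of `f` up to `ε * |h|`. At a good point
the metric derivative exists and equals `⨆ i, |c i|`. Any weak weak* derivative `T` then has this
norm: testing `T` on the 1-Lipschitz functions `LipZero.distFrom z₀ (d i)` gives `|c i| ≤ ‖T‖`, and
every number above the metric derivative is admissible in the Lipschitz bound, which gives the
converse. The Banach limit functional is a weak weak* derivative wherever a bound exists, so
everything reduces to almost every point being good.

On one absolutely continuous curve, let `M` be the supremum of the absolute derivatives of the
distances. It is integrable, since the variation of the curve's image in `ℓ^∞` dominates all the
distances at once. By density the displacement is at most the integral of `M`; where that integral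
has derivative `M`, an index almost attaining the supremum does the job.

Fubini passes from lines to `Ω`, but needs a measurable set. Hence goodness is restated with
rational `h` for a strongly measurable representative of `f`; continuity of `f` along lines recovers
real `h`. -/

/-- Near `0`, the curve `γ` is infinitesimally described by its distances to the points `d i`:
these distances are differentiable at `0`, and up to arbitrarily small first order errors one
of them realizes the distance to `γ 0`. -/
def DistDescribedAtZero (d : ℕ → X) (γ : ℝ → X) : Prop :=
  (∀ i, ∃ c, HasDerivAt (fun h => dist (d i) (γ h)) c 0) ∧
  ∀ ε > 0, ∃ i, ∀ᶠ h in 𝓝 (0 : ℝ),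
    dist (γ h) (γ 0) ≤ |dist (d i) (γ h) - dist (d i) (γ 0)| + ε * |h|

/-- The filter of punctured neighbourhoods of `0` in `ℚ`, for the topology of `ℝ`. -/
def ratZero : Filter ℚ := comap ((↑) : ℚ → ℝ) (𝓝[≠] 0)

instance : ratZero.IsCountablyGenerated := by unfold ratZero; infer_instance

theorem tendsto_coe_ratZero : Tendsto ((↑) : ℚ → ℝ) ratZero (𝓝[≠] 0) := tendsto_comap

/-- The analogue of `DistDescribedAtZero` for curves with rational parameter. -/
def DistDescribedAtRatZero (d : ℕ → X) (γ : ℚ → X) : Prop :=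
  (∀ i, ∃ c : ℝ, Tendsto (fun q : ℚ => (dist (d i) (γ q) - dist (d i) (γ 0)) / (q : ℝ))
    ratZero (𝓝 c)) ∧
  ∀ k : ℕ, ∃ i, ∀ᶠ q : ℚ in ratZero,
    dist (γ q) (γ 0) ≤ |dist (d i) (γ q) - dist (d i) (γ 0)| + 1 / ((k : ℝ) + 1) * |(q : ℝ)|

theorem hasDerivAt_zero_iff_tendsto_div {u : ℝ → ℝ} {c : ℝ} :
    HasDerivAt u c 0 ↔ Tendsto (fun h => (u h - u 0) / h) (𝓝[≠] 0) (𝓝 c) := by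
  rw [hasDerivAt_iff_tendsto_slope_zero]
  simp only [zero_add, smul_eq_mul, div_eq_inv_mul]

theorem DistDescribedAtZero.rat {d : ℕ → X} {γ : ℝ → X} (h : DistDescribedAtZero d γ) :
    DistDescribedAtRatZero d (fun q => γ q) := by
  refine ⟨fun i => ?_, fun k => ?_⟩
  · obtain ⟨c, hc⟩ := h.1 i
    rw [hasDerivAt_zero_iff_tendsto_div] at hc
    refine ⟨c, ?_⟩
    simpa [Function.comp_def] using hc.comp tendsto_coe_ratZero
  · obtain ⟨i, hi⟩ := h.2 (1 / ((k : ℝ) + 1)) (by positivity)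
    refine ⟨i, ?_⟩
    simpa using tendsto_coe_ratZero.eventually (hi.filter_mono nhdsWithin_le_nhds)

/-- The filter is punctured, so agreement at the base point `0` is a separate hypothesis. This
allows `f` to be exchanged with its strongly measurable representative. -/
theorem DistDescribedAtRatZero.congr {d : ℕ → X} {γ γ' : ℚ → X}
    (h : DistDescribedAtRatZero d γ) (h0 : γ 0 = γ' 0) (he : γ =ᶠ[ratZero] γ') :
    DistDescribedAtRatZero d γ' := by
  refine ⟨fun i => ?_, fun k => ?_⟩
  · obtain ⟨c, hc⟩ := h.1 i
    refine ⟨c, hc.congr' ?_⟩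
    filter_upwards [he] with q hq
    rw [hq, h0]
  · obtain ⟨i, hi⟩ := h.2 k
    refine ⟨i, ?_⟩
    filter_upwards [he, hi] with q hq hi
    rwa [← hq, ← h0]

/-- A closed condition on a continuous function that holds at small rational points holds at all
small points. -/
theorem eventually_mem_of_ratZero {Y : Type*} [TopologicalSpace Y] {k : ℝ → Y} {C : Set Y}
    (hC : IsClosed C) (hk : ∀ᶠ h in 𝓝[≠] (0 : ℝ), ContinuousAt k h)
    (h : ∀ᶠ q : ℚ in ratZero, k q ∈ C) : ∀ᶠ h in 𝓝[≠] (0 : ℝ), k h ∈ C := by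
  obtain ⟨s, hs, hsC⟩ := mem_comap.1 h
  obtain ⟨U, hUo, hU⟩ := mem_nhdsWithin_iff_exists_mem_nhds_inter.1 hs
  have hint : interior U ∩ {0}ᶜ ∈ 𝓝[≠] (0 : ℝ) :=
    inter_mem (mem_nhdsWithin_of_mem_nhds (interior_mem_nhds.2 hUo)) self_mem_nhdsWithin
  filter_upwards [hk, hint] with x hx hxU
  have hopen : IsOpen (interior U ∩ {0}ᶜ) := isOpen_interior.inter isOpen_compl_singleton
  have hcl : x ∈ closure ((interior U ∩ {0}ᶜ) ∩ range ((↑) : ℚ → ℝ)) :=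
    (Rat.isDenseEmbedding_coe_real.dense).open_subset_closure_inter hopen hxU
  refine hC.closure_subset_iff.2 ?_ (hx.continuousWithinAt.mem_closure_image hcl)
  rintro _ ⟨_, ⟨⟨hyU, hy0⟩, q, rfl⟩, rfl⟩
  exact hsC (hU ⟨interior_subset hyU, hy0⟩)

/-- Both requirements are closed conditions on functions continuous at small nonzero parameters, so
density of the rationals suffices. -/
theorem DistDescribedAtRatZero.real {d : ℕ → X} {γ : ℝ → X}
    (h : DistDescribedAtRatZero d (fun q => γ q)) (hγ : ∀ᶠ h in 𝓝 (0 : ℝ), ContinuousAt γ h) :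
    DistDescribedAtZero d γ := by
  have hγ' : ∀ᶠ h in 𝓝[≠] (0 : ℝ), ContinuousAt γ h := hγ.filter_mono nhdsWithin_le_nhds
  refine ⟨fun i => ?_, fun ε hε => ?_⟩
  · obtain ⟨c, hc⟩ := h.1 i
    refine ⟨c, hasDerivAt_zero_iff_tendsto_div.2 ?_⟩
    rw [Metric.nhds_basis_closedBall.tendsto_right_iff]
    intro ε hε
    refine eventually_mem_of_ratZero Metric.isClosed_closedBall ?_ ?_
    · filter_upwards [hγ', self_mem_nhdsWithin] with x hx hx0
      exact ((continuousAt_const.dist hx).sub continuousAt_const).div continuousAt_id hx0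
    · simpa using hc.eventually (Metric.closedBall_mem_nhds c hε)
  · obtain ⟨k, hk⟩ := exists_nat_one_div_lt hε
    obtain ⟨i, hi⟩ := h.2 k
    refine ⟨i, ?_⟩
    have key : ∀ᶠ h in 𝓝[≠] (0 : ℝ), |dist (d i) (γ h) - dist (d i) (γ 0)|
        + 1 / ((k : ℝ) + 1) * |h| - dist (γ h) (γ 0) ∈ Ici (0 : ℝ) := by
      refine eventually_mem_of_ratZero isClosed_Ici ?_ ?_
      · filter_upwards [hγ'] with x hx
        exact ((((continuousAt_const.dist hx).sub continuousAt_const).abs).add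
          (continuousAt_const.mul continuous_abs.continuousAt)).sub (hx.dist continuousAt_const)
      · filter_upwards [hi] with q hq
        simpa using hq
    -- At `h = 0` both sides vanish, so the punctured neighbourhood is enough.
    rw [← nhdsNE_sup_pure, eventually_sup]
    refine ⟨?_, by simp⟩
    filter_upwards [key] with x hx
    have h1 : 1 / ((k : ℝ) + 1) * |x| ≤ ε * |x| := by gcongr
    have h2 := mem_Ici.1 hx
    linarith

/-- With rational parameters and errors `1 / (k + 1)` all quantifiers are countable, and existence
of a limit along a countably generated filter is a measurable condition. -/
theorem measurableSet_distDescribedAtRatZero {α : Type*} [MeasurableSpace α] (d : ℕ → X)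
    {γ : α → ℚ → X} (hγ : ∀ q, StronglyMeasurable fun x => γ x q) :
    MeasurableSet {x | DistDescribedAtRatZero d (γ x)} := by
  have hd : ∀ i q, Measurable fun x => dist (d i) (γ x q) := fun i q =>
    ((stronglyMeasurable_const (b := d i)).dist (hγ q)).measurable
  have hd0 : ∀ q, Measurable fun x => dist (γ x q) (γ x 0) := fun q =>
    ((hγ q).dist (hγ 0)).measurable
  simp only [DistDescribedAtRatZero, ofPred_and, ofPred_forall, ofPred_exists]
  refine (MeasurableSet.iInter fun i => ?_).inter (MeasurableSet.iInter fun k =>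
    MeasurableSet.iUnion fun i => ?_)
  · simp only [← ofPred_exists]
    exact measurableSet_exists_tendsto fun q => ((hd i q).sub (hd i 0)).div_const _
  · obtain ⟨s, hs⟩ := ratZero.exists_antitone_basis
    simp only [hs.eventually_iff, ofPred_exists, true_and, ofPred_forall]
    refine MeasurableSet.iUnion fun n => MeasurableSet.iInter fun q =>
      MeasurableSet.iInter fun _ => ?_
    exact measurableSet_le (hd0 q) ((((hd i q).sub (hd i 0)).abs).add_const _)

end MetricCurves

/-! ### Absolutely continuous curves are described by distances at almost every time -/

section MetricCurves

variable {X : Type*} [MetricSpace X]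

/-- For `d i` close to `p`, the difference of distances is nearly `dist p q`. The error `dist (d i)
p` enters twice, hence `ε / 2`. -/
theorem dist_le_of_forall_abs_dist_sub_le {d : ℕ → X} {p q : X} {B : ℝ}
    (hp : p ∈ closure (range d)) (h : ∀ i, |dist (d i) p - dist (d i) q| ≤ B) : dist p q ≤ B := by
  refine le_of_forall_pos_le_add fun ε hε => ?_
  obtain ⟨_, ⟨i, rfl⟩, hi⟩ := Metric.mem_closure_iff.1 hp (ε / 2) (half_pos hε)
  have h1 := neg_abs_le (dist (d i) p - dist (d i) q)
  have h2 := h i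
  have h3 := dist_triangle p (d i) q
  rw [dist_comm] at hi
  rw [dist_comm p (d i)] at h3
  linarith

theorem AbsolutelyContinuousOnInterval.lipschitzWith_comp {Y : Type*} [PseudoMetricSpace Y]
    {γ : ℝ → X} {a b : ℝ} (hγ : AbsolutelyContinuousOnInterval γ a b) {g : X → Y}
    (hg : LipschitzWith 1 g) : AbsolutelyContinuousOnInterval (fun t => g (γ t)) a b :=
  squeeze_zero (fun _ => Finset.sum_nonneg fun _ _ => dist_nonneg)
    (fun _ => Finset.sum_le_sum fun _ _ => by simpa using hg.dist_le_mul _ _) hγ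

theorem AbsolutelyContinuousOnInterval.dist_left {γ : ℝ → X} {a b : ℝ}
    (hγ : AbsolutelyContinuousOnInterval γ a b) (p : X) :
    AbsolutelyContinuousOnInterval (fun t => dist p (γ t)) a b :=
  hγ.lipschitzWith_comp (LipschitzWith.dist_right p)

theorem AbsolutelyContinuousOnInterval.continuousOn_uIcc {γ : ℝ → X} {a b : ℝ}
    (hγ : AbsolutelyContinuousOnInterval γ a b) : ContinuousOn γ (uIcc a b) := by
  rw [absolutelyContinuousOnInterval_iff] at hγ
  refine Metric.continuousOn_iff.2 fun t ht ε hε => ?_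
  obtain ⟨δ, hδ, h⟩ := hγ ε hε
  refine ⟨δ, hδ, fun s hs hst => ?_⟩
  simpa using h (1, fun _ => (s, t)) ⟨fun _ _ => ⟨hs, ht⟩, by simp⟩ (by simpa using hst)

theorem KuratowskiEmbedding.lipschitzWith_embeddingOfSubset (d : ℕ → X) :
    LipschitzWith 1 (embeddingOfSubset d) :=
  LipschitzWith.of_dist_le_mul fun x y => by
    simpa using embeddingOfSubset_dist_le d x y

theorem KuratowskiEmbedding.abs_dist_sub_le_dist_embeddingOfSubset (d : ℕ → X) (p q : X) (i : ℕ) :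
    |dist (d i) p - dist (d i) q| ≤ dist (embeddingOfSubset d p) (embeddingOfSubset d q) := by
  have h := lp.norm_apply_le_norm (by simp) (embeddingOfSubset d p - embeddingOfSubset d q) i
  rw [lp.coeFn_sub, Pi.sub_apply, embeddingOfSubset_coe, embeddingOfSubset_coe,
    sub_sub_sub_cancel_right, Real.norm_eq_abs, dist_comm p, dist_comm q, ← dist_eq_norm] at h
  exact h

/-- A curve of bounded variation is controlled by a monotone real function. -/
theorem BoundedVariationOn.exists_monotoneOn_dist_le {γ : ℝ → X} {a b : ℝ} (hab : a ≤ b)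
    (hγ : BoundedVariationOn γ (Icc a b)) :
    ∃ V : ℝ → ℝ, MonotoneOn V (Icc a b) ∧
      ∀ s ∈ Icc a b, ∀ t ∈ Icc a b, dist (γ s) (γ t) ≤ |V s - V t| := by
  have hl := hγ.locallyBoundedVariationOn
  have ha := left_mem_Icc.2 hab
  refine ⟨variationOnFromTo γ (Icc a b) a, variationOnFromTo.monotoneOn hl ha, ?_⟩
  have key : ∀ s ∈ Icc a b, ∀ t ∈ Icc a b, s ≤ t → dist (γ s) (γ t) ≤
      |variationOnFromTo γ (Icc a b) a s - variationOnFromTo γ (Icc a b) a t| := by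
    intro s hs t ht hst
    rw [abs_sub_comm]
    refine le_trans ?_ (le_abs_self _)
    rw [variationOnFromTo.sub_right hl ha ht hs, variationOnFromTo.eq_of_le _ _ hst, dist_edist]
    exact ENNReal.toReal_mono (hl s t hs ht)
      (eVariationOn.edist_le γ ⟨hs, le_rfl, hst⟩ ⟨ht, hst, le_rfl⟩)
  intro s hs t ht
  rcases le_total s t with h | h
  · exact key s hs t ht h
  · rw [dist_comm, abs_sub_comm]
    exact key t ht s hs h

theorem abs_deriv_le_abs_deriv_of_abs_sub_le {u v : ℝ → ℝ} {t : ℝ} (hu : DifferentiableAt ℝ u t)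
    (hv : DifferentiableAt ℝ v t) (h : ∀ᶠ s in 𝓝 t, |u s - u t| ≤ |v s - v t|) :
    |deriv u t| ≤ |deriv v t| := by
  have h1 := (hasDerivAt_iff_tendsto_slope.1 hu.hasDerivAt).abs
  have h2 := (hasDerivAt_iff_tendsto_slope.1 hv.hasDerivAt).abs
  refine le_of_tendsto_of_tendsto h1 h2 ?_
  filter_upwards [h.filter_mono nhdsWithin_le_nhds] with s hs
  simp only [slope_def_field, abs_div]
  gcongr

/-- The supremum of the derivatives of the distances of an absolutely continuous curve to
countably many points is integrable. -/
theorem AbsolutelyContinuousOnInterval.intervalIntegrable_iSup_deriv_dist {γ : ℝ → X} {a b : ℝ}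
    (hγ : AbsolutelyContinuousOnInterval γ a b) (hab : a ≤ b) (d : ℕ → X) :
    (∀ᵐ t, t ∈ Ioo a b → ∀ i, DifferentiableAt ℝ (fun s => dist (d i) (γ s)) t ∧
      |deriv (fun s => dist (d i) (γ s)) t| ≤ ⨆ j, |deriv (fun s => dist (d j) (γ s)) t|) ∧
    IntervalIntegrable (fun t => ⨆ j, |deriv (fun s => dist (d j) (γ s)) t|) volume a b := by
  have hI : uIcc a b = Icc a b := uIcc_of_le hab
  -- In `ℓ^∞` one variation function `V` controls the distances to all `d i` simultaneously, so
  -- `|deriv V|` will dominate their supremum.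
  have hbv := (hγ.lipschitzWith_comp
    (KuratowskiEmbedding.lipschitzWith_embeddingOfSubset d)).boundedVariationOn
  rw [hI] at hbv
  obtain ⟨V, hV, hVd⟩ := hbv.exists_monotoneOn_dist_le hab
  have hVint : IntervalIntegrable (deriv V) volume a b :=
    MonotoneOn.intervalIntegrable_deriv (by rwa [hI])
  have hVdiff : ∀ᵐ t, t ∈ Ioo a b → DifferentiableAt ℝ V t := by
    filter_upwards [hV.ae_differentiableWithinAt_of_mem] with t ht hta
    exact (ht (Ioo_subset_Icc_self hta)).differentiableAt (Icc_mem_nhds hta.1 hta.2)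
  have hudiff : ∀ᵐ t, t ∈ Ioo a b → ∀ i, DifferentiableAt ℝ (fun s => dist (d i) (γ s)) t := by
    filter_upwards [ae_all_iff.2 fun i => (hγ.dist_left (d i)).ae_differentiableAt] with t ht hta i
    exact ht i (hI ▸ Ioo_subset_Icc_self hta)
  have hbound : ∀ᵐ t, t ∈ Ioo a b →
      ∀ i, |deriv (fun s => dist (d i) (γ s)) t| ≤ |deriv V t| := by
    filter_upwards [hVdiff, hudiff] with t h1 h2 hta i
    refine abs_deriv_le_abs_deriv_of_abs_sub_le (h2 hta i) (h1 hta) ?_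
    filter_upwards [Icc_mem_nhds hta.1 hta.2] with s hs
    exact (KuratowskiEmbedding.abs_dist_sub_le_dist_embeddingOfSubset d _ _ i).trans
      (hVd s hs t (Ioo_subset_Icc_self hta))
  refine ⟨?_, hVint.mono_fun ?_ ?_⟩
  · filter_upwards [hbound, hudiff] with t ht hu hta i
    -- The bound by `|deriv V t|` makes this a genuine supremum, not the default value `0` of an
    -- unbounded one.
    exact ⟨hu hta i, le_ciSup (f := fun j => |deriv (fun s => dist (d j) (γ s)) t|)
      ⟨_, by rintro _ ⟨j, rfl⟩; exact ht hta j⟩ i⟩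
  · exact (Measurable.iSup fun i =>
      (measurable_deriv fun s => dist (d i) (γ s)).abs).aestronglyMeasurable
  · have hne : ∀ᵐ t : ℝ, t ≠ b := by simp [ae_iff, measure_singleton]
    rw [uIoc_of_le hab, EventuallyLE, ae_restrict_iff' measurableSet_Ioc]
    filter_upwards [hbound, hne] with t ht htb hta
    rw [Real.norm_eq_abs, Real.norm_eq_abs, abs_of_nonneg (Real.iSup_nonneg fun i => abs_nonneg _)]
    exact ciSup_le fun i => ht ⟨hta.1, lt_of_le_of_ne hta.2 htb⟩ i

/-- The distance between two points of an absolutely continuous curve is at most the integral of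
a common bound for the derivatives of its distances to a dense sequence. -/
theorem AbsolutelyContinuousOnInterval.dist_le_abs_integral {d : ℕ → X} {γ : ℝ → X} {a b : ℝ}
    (hγ : AbsolutelyContinuousOnInterval γ a b) (hab : a ≤ b)
    (hd : ∀ t ∈ Icc a b, γ t ∈ closure (range d)) {M : ℝ → ℝ}
    (hM : ∀ᵐ t, t ∈ Ioo a b → ∀ i, |deriv (fun s => dist (d i) (γ s)) t| ≤ M t)
    (hMint : IntervalIntegrable M volume a b) {s t : ℝ} (hs : s ∈ Icc a b) (ht : t ∈ Icc a b) :
    dist (γ s) (γ t) ≤ |(∫ r in a..s, M r) - ∫ r in a..t, M r| := by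
  have hI : uIcc a b = Icc a b := uIcc_of_le hab
  have hsub : uIcc t s ⊆ uIcc a b := by
    rw [hI]
    exact Icc_subset_Icc (le_inf ht.1 hs.1) (sup_le ht.2 hs.2)
  have hma : ∀ r ∈ Icc a b, IntervalIntegrable M volume a r := fun r hr =>
    hMint.mono_set (by rw [hI, uIcc_of_le hr.1]; exact Icc_subset_Icc_right hr.2)
  rw [intervalIntegral.integral_interval_sub_left (hma s hs) (hma t ht)]
  refine dist_le_of_forall_abs_dist_sub_le (hd s hs) fun i => ?_
  -- Each distance is absolutely continuous, hence the integral of its derivative.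
  rw [← ((hγ.dist_left (d i)).mono hsub).integral_deriv_eq_sub, ← Real.norm_eq_abs]
  refine intervalIntegral.norm_integral_le_abs_of_norm_le ?_ (hMint.mono_set hsub)
  have hne : ∀ᵐ t : ℝ, t ≠ b := by simp [ae_iff, measure_singleton]
  rw [ae_restrict_iff' measurableSet_uIoc]
  filter_upwards [hM, hne] with r hr hrb hrt
  have hr2 : r ∈ Ioc a b :=
    ⟨(le_inf ht.1 hs.1).trans_lt hrt.1, hrt.2.trans (sup_le ht.2 hs.2)⟩
  exact hr ⟨hr2.1, lt_of_le_of_ne hr2.2 hrb⟩ i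

/-- An absolutely continuous curve in the closure of `{d i}` is, at almost every time,
infinitesimally described by its distances to the points `d i`. -/
theorem AbsolutelyContinuousOnInterval.ae_distDescribedAtZero {d : ℕ → X} {γ : ℝ → X} {a b : ℝ}
    (hγ : AbsolutelyContinuousOnInterval γ a b)
    (hd : ∀ t ∈ Icc a b, γ t ∈ closure (range d)) :
    ∀ᵐ t, t ∈ Ioo a b → DistDescribedAtZero d (fun h => γ (t + h)) := by
  rcases le_or_gt b a with hab | hab
  · simp [Ioo_eq_empty_of_le hab]
  obtain ⟨hder, hMint⟩ := hγ.intervalIntegrable_iSup_deriv_dist hab.le d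
  have hdist := fun (s : ℝ) (hs : s ∈ Icc a b) (t : ℝ) (ht : t ∈ Icc a b) =>
    hγ.dist_le_abs_integral hab.le hd (hder.mono fun t h hta i => (h hta i).2) hMint hs ht
  have hM0 : ∀ t, 0 ≤ ⨆ j, |deriv (fun s => dist (d j) (γ s)) t| := fun t =>
    Real.iSup_nonneg fun i => abs_nonneg _
  have hMi : ∀ t, ∀ ε > 0, ∃ i, (⨆ j, |deriv (fun s => dist (d j) (γ s)) t|) - ε <
      |deriv (fun s => dist (d i) (γ s)) t| := fun t ε hε =>
    exists_lt_of_lt_ciSup (sub_lt_self _ hε)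
  obtain ⟨M, hM⟩ : ∃ M : ℝ → ℝ, M = fun t => ⨆ j, |deriv (fun s => dist (d j) (γ s)) t| :=
    ⟨_, rfl⟩
  simp only [← congrFun hM] at hdist hMint hM0 hMi
  filter_upwards [hder, hMint.ae_hasDerivAt_integral] with t h1 h3 hta
  have htI := Ioo_subset_Icc_self hta
  have hJ := h3 (uIcc_of_le hab.le ▸ htI) a left_mem_uIcc
  refine ⟨fun i => ⟨_, HasDerivAt.comp_const_add t 0
    (by rw [add_zero]; exact (h1 hta i).1.hasDerivAt)⟩, fun ε hε => ?_⟩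
  -- Three errors of size `ε / 3`: the choice of `i` in the supremum, and the first-order expansions
  -- of the distance to `d i` and of the integral of `M`.
  obtain ⟨i, hi⟩ := hMi t (ε / 3) (by linarith)
  refine ⟨i, ?_⟩
  have e1 := (hasDerivAt_iff_isLittleO_nhds_zero.1 (h1 hta i).1.hasDerivAt).def
    (show 0 < ε / 3 by linarith)
  have e2 := (hasDerivAt_iff_isLittleO_nhds_zero.1 hJ).def (show 0 < ε / 3 by linarith)
  have e3 : ∀ᶠ h in 𝓝 (0 : ℝ), t + h ∈ Icc a b :=
    (Continuous.tendsto' (by fun_prop : Continuous fun h : ℝ => t + h) 0 t (by simp)).eventually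
      (Icc_mem_nhds hta.1 hta.2)
  filter_upwards [e1, e2, e3] with h k1 k2 k3
  have k4 := hdist (t + h) k3 t htI
  simp only [Real.norm_eq_abs, smul_eq_mul] at k1 k2
  rw [add_zero]
  generalize (∫ r in a..(t + h), M r) - ∫ r in a..t, M r = A at *
  generalize dist (d i) (γ (t + h)) - dist (d i) (γ t) = B at *
  generalize deriv (fun s => dist (d i) (γ s)) t = c at *
  have k5 : |A| ≤ ε / 3 * |h| + |h| * M t := by
    have := abs_add_le (A - h * M t) (h * M t)
    rw [sub_add_cancel, abs_mul h, abs_of_nonneg (hM0 t)] at this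
    linarith
  have k6 : |h| * |c| ≤ |B| + ε / 3 * |h| := by
    have := abs_sub_abs_le_abs_sub (h * c) B
    rw [abs_sub_comm, abs_mul] at this
    linarith
  have k7 : |h| * (M t - ε / 3) ≤ |h| * |c| := mul_le_mul_of_nonneg_left hi.le (abs_nonneg h)
  linarith

end MetricCurves

/-! ### Metric derivatives and norms of weak weak* derivatives at a good point -/

section WeakDerivatives

variable {n : ℕ} {X : Type*} [MetricSpace X] {z₀ : X}

/-- The function `d(p, ·) - d(p, z₀)`. -/
noncomputable def LipZero.distFrom (z₀ p : X) : LipZero X z₀ :=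
  ⟨fun x => dist p x - dist p z₀,
    ⟨1, LipschitzWith.of_dist_le_mul fun x y => by
      rw [Real.dist_eq, sub_sub_sub_cancel_right, dist_comm p, dist_comm p, NNReal.coe_one, one_mul]
      exact abs_dist_sub_le x y p⟩, sub_self _⟩

theorem LipZero.distFrom_apply (p x : X) :
    LipZero.distFrom z₀ p x = dist p x - dist p z₀ := rfl

theorem LipZero.norm_distFrom_le (p : X) : ‖LipZero.distFrom z₀ p‖ ≤ 1 := by
  refine LipZero.norm_le_of_abs_sub_le _ zero_le_one fun x y => ?_
  rw [distFrom_apply, distFrom_apply, sub_sub_sub_cancel_right, dist_comm p, dist_comm p, one_mul]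
  exact abs_dist_sub_le x y p

variable {f : EuclideanSpace ℝ (Fin n) → X} {ν x : EuclideanSpace ℝ (Fin n)}

theorem HasMetricDirDeriv.nonneg {m : ℝ} (h : HasMetricDirDeriv f ν x m) : 0 ≤ m :=
  ge_of_tendsto' h fun _ => by positivity

theorem HasMetricDirDeriv.dirLipBound {m C : ℝ} (h : HasMetricDirDeriv f ν x m) (hC : m ≤ C) :
    DirLipBound z₀ f ν x C := by
  intro φ
  have h1 : Tendsto (fun h : ℝ => ENNReal.ofReal (‖φ‖ * (dist (f (x + h • ν)) (f x) / |h|)))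
      (𝓝[≠] 0) (𝓝 (ENNReal.ofReal (‖φ‖ * m))) := ENNReal.tendsto_ofReal (h.const_mul _)
  refine (limsup_le_limsup (Eventually.of_forall fun h => ?_)).trans (h1.limsup_eq.trans_le ?_)
  · refine ENNReal.ofReal_le_ofReal ?_
    rw [← mul_div_assoc]
    gcongr
    exact LipZero.abs_sub_le φ _ _
  · refine ENNReal.ofReal_le_ofReal ?_
    rw [mul_comm]
    gcongr

theorem HasMetricDirDeriv.exists_dirLipBound {m : ℝ} (h : HasMetricDirDeriv f ν x m) :
    ∃ C > 0, DirLipBound z₀ f ν x C :=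
  -- The bound must be positive, while `m` may be `0`.
  ⟨m + 1, by linarith [h.nonneg], h.dirLipBound (by linarith)⟩

theorem HasMetricDirDeriv.metricDirDeriv_eq {m : ℝ} (h : HasMetricDirDeriv f ν x m) :
    metricDirDeriv f ν x = m := by
  have hex : ∃ m, HasMetricDirDeriv f ν x m := ⟨m, h⟩
  rw [metricDirDeriv, dif_pos hex]
  exact tendsto_nhds_unique hex.choose_spec h

/-- If a curve is described by its distances to the points `d i`, then its metric derivative
exists and is the supremum of the derivatives of these distances. -/
theorem DistDescribedAtZero.exists_hasMetricDirDeriv {d : ℕ → X}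
    (h : DistDescribedAtZero d fun t : ℝ => f (x + t • ν)) :
    ∃ c : ℕ → ℝ, (∀ i, HasLineDerivAt ℝ (fun y => dist (d i) (f y)) (c i) x ν) ∧
      HasMetricDirDeriv f ν x (⨆ i, |c i|) := by
  obtain ⟨h1, h2⟩ := h
  choose c hc using h1
  refine ⟨c, hc, ?_⟩
  have hq : ∀ i, Tendsto (fun t : ℝ => |dist (d i) (f (x + t • ν)) - dist (d i) (f x)| / |t|)
      (𝓝[≠] 0) (𝓝 |c i|) := fun i => by
    simpa [abs_div] using (hasDerivAt_zero_iff_tendsto_div.1 (hc i)).abs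
  have hlow : ∀ i (t : ℝ), |dist (d i) (f (x + t • ν)) - dist (d i) (f x)| / |t| ≤
      dist (f (x + t • ν)) (f x) / |t| := fun i t => by
    rw [dist_comm (d i), dist_comm (d i)]
    gcongr
    exact abs_dist_sub_le _ _ _
  have hup : ∀ ε > 0, ∃ i, ∀ᶠ t in 𝓝[≠] (0 : ℝ), dist (f (x + t • ν)) (f x) / |t| ≤
      |dist (d i) (f (x + t • ν)) - dist (d i) (f x)| / |t| + ε := by
    intro ε hε
    obtain ⟨i, hi⟩ := h2 ε hε
    refine ⟨i, ?_⟩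
    filter_upwards [hi.filter_mono nhdsWithin_le_nhds, self_mem_nhdsWithin] with t ht ht0
    have ht0' : 0 < |t| := abs_pos.2 ht0
    rw [div_le_iff₀ ht0', add_mul, div_mul_cancel₀ _ ht0'.ne']
    simpa using ht
  -- The index chosen for `ε = 1` bounds the quotients of `f`, and these bound every `|c j|`.
  have hbdd : BddAbove (range fun i => |c i|) := by
    obtain ⟨i, hi⟩ := hup 1 one_pos
    refine ⟨|c i| + 1, ?_⟩
    rintro _ ⟨j, rfl⟩
    refine le_of_tendsto_of_tendsto (hq j) ((hq i).add_const 1) ?_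
    filter_upwards [hi] with t ht using (hlow j t).trans ht
  rw [HasMetricDirDeriv, tendsto_order]
  refine ⟨fun a ha => ?_, fun a ha => ?_⟩
  · obtain ⟨i, hi⟩ := exists_lt_of_lt_ciSup ha
    filter_upwards [(hq i).eventually_const_lt hi] with t ht using ht.trans_le (hlow i t)
  · set ε := (a - ⨆ i, |c i|) / 2 with hε
    obtain ⟨i, hi⟩ := hup ε (by rw [hε]; linarith)
    have hci : |c i| < a - ε := (le_ciSup hbdd i).trans_lt (by rw [hε]; linarith)
    filter_upwards [hi, (hq i).eventually_lt_const hci] with t ht ht'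
    linarith

/-- At a point where `f` is described by its distances to the points `d i`, the norm of any
weak weak* derivative is the metric derivative. -/
theorem IsWeakWeakStarDirDeriv.hasMetricDirDeriv_norm {d : ℕ → X}
    {T : StrongDual ℝ (LipZero X z₀)} (hT : IsWeakWeakStarDirDeriv f ν x T)
    (h : DistDescribedAtZero d fun t : ℝ => f (x + t • ν)) : HasMetricDirDeriv f ν x ‖T‖ := by
  obtain ⟨c, hc, hm⟩ := h.exists_hasMetricDirDeriv
  suffices ‖T‖ = ⨆ i, |c i| by rwa [this]
  refine le_antisymm (le_of_forall_pos_le_add fun ε hε => ?_) (ciSup_le fun i => ?_)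
  · exact hT.norm_le _ (by linarith [hm.nonneg]) (hm.dirLipBound (by linarith))
  · have h1 : T (LipZero.distFrom z₀ (d i)) = c i :=
      hT.apply_eq _ _ (HasDerivAt.sub_const (dist (d i) z₀) (hc i))
    rw [← h1, ← Real.norm_eq_abs]
    exact (T.le_opNorm _).trans
      (mul_le_of_le_one_right (norm_nonneg T) (LipZero.norm_distFrom_le (d i)))

theorem BanachLimit.abs_le_of_eventually_abs_le (Φ : BanachLimit) (a : lp (fun _ : ℕ => ℝ) ∞)
    (c : ℝ) (h : ∀ᶠ k in atTop, |a k| ≤ c) : |Φ.toFun a| ≤ c := by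
  refine abs_le'.2 ⟨Φ.le_of_eventually_le a c (h.mono fun k hk => (le_abs_self _).trans hk), ?_⟩
  rw [← map_neg]
  exact Φ.le_of_eventually_le (-a) c (h.mono fun k hk => (neg_le_abs (a k)).trans hk)

/-- Wherever it is defined, the functional constructed from a Banach limit is a weak weak*
derivative. -/
theorem isWeakWeakStarDirDeriv_weakWeakStarDirDeriv (Φ : BanachLimit) {δ : ℕ → ℝ}
    (hpos : ∀ k, 0 < δ k) (hlim : Tendsto δ atTop (𝓝 0))
    (hb : ∃ C > 0, DirLipBound z₀ f ν x C) :
    IsWeakWeakStarDirDeriv f ν x (weakWeakStarDirDeriv Φ hpos hlim z₀ f ν x) := by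
  have happ : ∀ φ : LipZero X z₀, weakWeakStarDirDeriv Φ hpos hlim z₀ f ν x φ =
      Φ.toFun ⟨lipDiffQuot δ f ν x φ, memℓp_lipDiffQuot hpos hlim hb φ⟩ := fun φ => by
    rw [weakWeakStarDirDeriv, dif_pos hb]
    rfl
  refine ⟨hb, fun φ c hc => ?_, fun C hC hCb => ?_⟩
  · rw [happ]
    refine Φ.eq_of_tendsto _ _ ?_
    have hδ : Tendsto δ atTop (𝓝[≠] 0) :=
      tendsto_nhdsWithin_iff.2 ⟨hlim, Eventually.of_forall fun k => (hpos k).ne'⟩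
    have := (hasDerivAt_zero_iff_tendsto_div.1 hc).comp hδ
    simpa [Function.comp_def, lipDiffQuot] using this
  · refine ContinuousLinearMap.opNorm_le_bound _ hC.le fun φ => ?_
    rw [happ, Real.norm_eq_abs]
    refine le_of_forall_pos_le_add fun ε hε => Φ.abs_le_of_eventually_abs_le _ _ ?_
    exact eventually_abs_lipDiffQuot_le hpos hlim hC hCb φ hε

end WeakDerivatives

/-! ### From lines to almost every point of `Ω` -/

section Lines

variable {n : ℕ} {X : Type*} [MetricSpace X]

/-- Measurable, essentially separably valued maps are strongly measurable. -/
theorem aestronglyMeasurable_of_nullMeasurable_of_isSeparable {α : Type*} [MeasurableSpace α]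
    {μ : Measure α} [MeasurableSpace X] [BorelSpace X] {f : α → X} (hf : NullMeasurable f μ)
    {t : Set X} (ht : TopologicalSpace.IsSeparable t) (hft : ∀ᵐ x ∂μ, f x ∈ t) :
    AEStronglyMeasurable f μ := by
  have := ht.secondCountableTopology
  exact aestronglyMeasurable_iff_aemeasurable_separable.2
    ⟨hf.aemeasurable_of_aerange hft, t, ht, hft⟩

theorem EssSeparablyValued.exists_dense_seq [Nonempty X] {f : EuclideanSpace ℝ (Fin n) → X}
    {Ω : Set (EuclideanSpace ℝ (Fin n))} (hf : EssSeparablyValued f Ω) :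
    ∃ d : ℕ → X, ∀ᵐ x, x ∈ Ω → f x ∈ closure (range d) := by
  obtain ⟨S, hS, hS0, c, hc, hfc⟩ := hf
  -- An extra point makes the countable set nonempty, so that a sequence can enumerate it.
  obtain ⟨d, hd⟩ := (hc.insert (Classical.arbitrary X)).exists_eq_range (insert_nonempty _ _)
  refine ⟨d, ?_⟩
  filter_upwards [measure_eq_zero_iff_ae_notMem.1 hS0] with x hxS hx
  rw [← hd]
  exact closure_mono (subset_insert _ _) (hfc ⟨x, ⟨hx, hxS⟩, rfl⟩)

/-- A line in direction `ν` is invariant under translation by multiples of `ν`. -/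
theorem mem_lineThrough_of_mem {ν p x : EuclideanSpace ℝ (Fin n)} (hx : x ∈ lineThrough ν p)
    (t : ℝ) : x + t • ν ∈ lineThrough ν p := by
  obtain ⟨s, rfl⟩ := hx
  exact ⟨s + t, by simp only [add_smul, add_assoc]⟩

variable {f : EuclideanSpace ℝ (Fin n) → X} {Ω : Set (EuclideanSpace ℝ (Fin n))}
  {ν : EuclideanSpace ℝ (Fin n)}

theorem continuous_line (x ν : EuclideanSpace ℝ (Fin n)) : Continuous fun t : ℝ => x + t • ν := by
  fun_prop

theorem IsOpen.exists_rat_Icc_subset {U : Set ℝ} (hU : IsOpen U) {t : ℝ} (ht : t ∈ U) :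
    ∃ a b : ℚ, t ∈ Ioo (a : ℝ) b ∧ Icc (a : ℝ) b ⊆ U := by
  obtain ⟨ε, hε, hεU⟩ := Metric.isOpen_iff.1 hU t ht
  obtain ⟨a, ha1, ha2⟩ := exists_rat_btwn (sub_lt_self t hε)
  obtain ⟨b, hb1, hb2⟩ := exists_rat_btwn (lt_add_of_pos_right t hε)
  refine ⟨a, b, ⟨ha2, hb1⟩, fun s hs => hεU ?_⟩
  rw [Real.ball_eq_Ioo]
  exact ⟨ha1.trans_le hs.1, hs.2.trans_lt hb2⟩

/-- A property that holds at almost every point holds at almost every point of almost every line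
with a given direction. -/
theorem ae_ae_line {P : EuclideanSpace ℝ (Fin n) → Prop} (hP : ∀ᵐ x, P x)
    (ν : EuclideanSpace ℝ (Fin n)) :
    ∀ᵐ y : EuclideanSpace ℝ (Fin n), ∀ᵐ t : ℝ, P (y + t • ν) := by
  obtain ⟨s, hsP, hs, hs0⟩ := exists_measurable_superset_of_null (ae_iff.1 hP)
  have h := (ae_ae_add_linearMap_mem_iff (LinearMap.toSpanSingleton ℝ _ ν) volume
    (volume : Measure (EuclideanSpace ℝ (Fin n))) hs.compl).2
    (measure_eq_zero_iff_ae_notMem.1 hs0)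
  filter_upwards [h] with y hy
  filter_upwards [hy] with t ht
  by_contra hn
  exact ht (hsP hn)

/-- A null set of points can be avoided together with all its rational translates. -/
theorem ae_forall_rat_line {P : EuclideanSpace ℝ (Fin n) → Prop} (hP : ∀ᵐ x, P x)
    (ν : EuclideanSpace ℝ (Fin n)) :
    ∀ᵐ x : EuclideanSpace ℝ (Fin n), ∀ q : ℚ, P (x + (q : ℝ) • ν) :=
  ae_all_iff.2 fun q =>
    (measurePreserving_add_right volume ((q : ℝ) • ν)).quasiMeasurePreserving.ae hP

/-- `f` is absolutely continuous on the segments in `Ω` of the line through `x` in direction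
`ν`. -/
def ACOnLine (f : EuclideanSpace ℝ (Fin n) → X) (Ω : Set (EuclideanSpace ℝ (Fin n)))
    (ν x : EuclideanSpace ℝ (Fin n)) : Prop :=
  ∀ a b : ℝ, a ≤ b → (∀ t ∈ Icc a b, x + t • ν ∈ Ω) →
    AbsolutelyContinuousOnInterval (fun t : ℝ => f (x + t • ν)) a b

/-- The family consists of full lines, so a point covered by it brings all its translates along `ν`.
-/
theorem ACOnAlmostEveryLine.ae_acOnLine (hf : ACOnAlmostEveryLine f Ω ν) :
    ∀ᵐ x, x ∈ Ω → ∀ t : ℝ, ACOnLine f Ω ν (x + t • ν) := by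
  obtain ⟨L, hL, hLΩ, hac⟩ := hf
  filter_upwards [measure_eq_zero_iff_ae_notMem.1 hLΩ] with x hx hxΩ t
  obtain ⟨l, hl, hxl⟩ : x ∈ ⋃₀ L := by
    by_contra h
    exact hx ⟨hxΩ, h⟩
  obtain ⟨p, rfl⟩ := hL l hl
  exact hac _ hl _ (mem_lineThrough_of_mem hxl t)

theorem ACOnLine.continuousAt {x : EuclideanSpace ℝ (Fin n)} (hf : ACOnLine f Ω ν x)
    (hΩ : IsOpen Ω) {t : ℝ} (ht : x + t • ν ∈ Ω) :
    ContinuousAt (fun t : ℝ => f (x + t • ν)) t := by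
  obtain ⟨a, b, htab, hab⟩ :=
    (hΩ.preimage (continuous_line x ν)).exists_rat_Icc_subset (t := t) ht
  have hle := (htab.1.trans htab.2).le
  have hc := (hf a b hle hab).continuousOn_uIcc
  rw [uIcc_of_le hle] at hc
  exact hc.continuousAt (Icc_mem_nhds htab.1 htab.2)

/-- On a line on which `f` is absolutely continuous, `f` is almost everywhere infinitesimally
described by its distances to a sequence that is dense in almost all values. -/
theorem ACOnLine.ae_distDescribedAtZero {x : EuclideanSpace ℝ (Fin n)} (hf : ACOnLine f Ω ν x)
    (hΩ : IsOpen Ω) {d : ℕ → X}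
    (hd : ∀ᵐ t : ℝ, x + t • ν ∈ Ω → f (x + t • ν) ∈ closure (range d)) :
    ∀ᵐ t : ℝ, x + t • ν ∈ Ω → DistDescribedAtZero d fun h : ℝ => f (x + (t + h) • ν) := by
  have hU := hΩ.preimage (continuous_line x ν)
  -- A set of full measure is dense and `f` is continuous along the line, so no exceptional `t`
  -- remain.
  have hd' : ∀ t : ℝ, x + t • ν ∈ Ω → f (x + t • ν) ∈ closure (range d) := by
    intro t ht
    have hcl := (Measure.dense_of_ae hd).open_subset_closure_inter hU ht
    refine isClosed_closure.closure_subset_iff.2 ?_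
      ((hf.continuousAt hΩ ht).continuousWithinAt.mem_closure_image hcl)
    rintro _ ⟨s, ⟨hs, hs'⟩, rfl⟩
    exact hs' hs
  have key : ∀ a b : ℚ, ∀ᵐ t : ℝ, Icc (a : ℝ) b ⊆ (fun t : ℝ => x + t • ν) ⁻¹' Ω →
      t ∈ Ioo (a : ℝ) b → DistDescribedAtZero d fun h : ℝ => f (x + (t + h) • ν) := by
    intro a b
    by_cases hab : Icc (a : ℝ) b ⊆ (fun t : ℝ => x + t • ν) ⁻¹' Ω
    · rcases le_or_gt (a : ℝ) b with hle | hlt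
      · filter_upwards [(hf a b hle hab).ae_distDescribedAtZero fun t ht => hd' t (hab ht)]
          with t ht _ using ht
      · simp [Ioo_eq_empty_of_le hlt.le]
    · simp [hab]
  filter_upwards [ae_all_iff.2 fun a => ae_all_iff.2 (key a)] with t ht htΩ
  obtain ⟨a, b, htab, hab⟩ := hU.exists_rat_Icc_subset (t := t) htΩ
  exact ht a b hab htab

/-- Almost everywhere in `Ω`, the restriction of `f` to lines of direction `ν` is infinitesimally
described by distances to a sequence that is dense in almost all values. -/
theorem ACOnAlmostEveryLine.ae_distDescribedAtZero [MeasurableSpace X] [BorelSpace X]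
    (hΩ : IsOpen Ω) (hf_meas : NullMeasurable f (volume.restrict Ω)) {d : ℕ → X}
    (hd : ∀ᵐ x, x ∈ Ω → f x ∈ closure (range d)) (hf : ACOnAlmostEveryLine f Ω ν) :
    ∀ᵐ x, x ∈ Ω → DistDescribedAtZero d fun h : ℝ => f (x + h • ν) := by
  obtain ⟨g, hg, hfg⟩ := aestronglyMeasurable_of_nullMeasurable_of_isSeparable hf_meas
    (countable_range d).isSeparable.closure ((ae_restrict_iff' hΩ.measurableSet).2 hd)
  rw [EventuallyEq, ae_restrict_iff' hΩ.measurableSet] at hfg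
  have hratΩ : ∀ x ∈ Ω, ∀ᶠ q : ℚ in ratZero, x + (q : ℝ) • ν ∈ Ω := fun x hx =>
    (tendsto_coe_ratZero.mono_right nhdsWithin_le_nhds).eventually
      ((hΩ.preimage (continuous_line x ν)).mem_nhds (by simpa using hx))
  have hrat := ae_forall_rat_line hfg ν
  have hac := hf.ae_acOnLine
  set A : Set (EuclideanSpace ℝ (Fin n)) :=
    {x | x ∈ Ω → DistDescribedAtRatZero d fun q : ℚ => g (x + (q : ℝ) • ν)} with hA_def
  have hA : MeasurableSet A := by
    have := hΩ.measurableSet.compl.union (measurableSet_distDescribedAtRatZero d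
      (γ := fun x (q : ℚ) => g (x + (q : ℝ) • ν))
      fun q => hg.comp_measurable (measurable_add_const _))
    convert this using 1
    ext x
    simp [hA_def, imp_iff_not_or]
  have hAae : ∀ᵐ x, x ∈ A := by
    -- Fubini: the measurable set `A` has full measure once almost every line meets it in full
    -- measure.
    refine (ae_ae_add_linearMap_mem_iff (LinearMap.toSpanSingleton ℝ _ ν) volume volume hA).1 ?_
    filter_upwards [ae_ae_line hrat ν, ae_ae_line hac ν, ae_ae_line hd ν] with y h1 h2 h3
    -- If there is no such `t`, the line misses `Ω` at almost every parameter and membership in `A`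
    -- is vacuous there.
    by_cases hy : ∃ t : ℝ, y + t • ν ∈ Ω ∧ ∀ s : ℝ, ACOnLine f Ω ν (y + t • ν + s • ν)
    · obtain ⟨t₀, -, hac₀⟩ := hy
      have hacy : ACOnLine f Ω ν y := by simpa [add_assoc, ← add_smul] using hac₀ (-t₀)
      filter_upwards [hacy.ae_distDescribedAtZero hΩ h3, h1] with t ht ht1 htΩ
      refine (ht htΩ).rat.congr ?_ ?_
      · have := ht1 0
        simp only [Rat.cast_zero, zero_smul, add_zero] at this
        simpa using this htΩ
      · filter_upwards [hratΩ _ htΩ] with q hq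
        have := ht1 q hq
        simpa [add_smul, add_assoc] using this
    · filter_upwards [h2] with t ht htΩ
      exact absurd ⟨t, htΩ, ht htΩ⟩ hy
  filter_upwards [hAae, hrat, hac] with x hxA hx hxac hxΩ
  have hxl : ACOnLine f Ω ν x := by simpa using hxac hxΩ 0
  have hrz : DistDescribedAtRatZero d fun q : ℚ => f (x + (q : ℝ) • ν) := by
    refine (hxA hxΩ).congr ?_ ?_
    · have := hx 0
      simp only [Rat.cast_zero, zero_smul, add_zero] at this ⊢
      exact (this hxΩ).symm
    · filter_upwards [hratΩ x hxΩ] with q hq using (hx q hq).symm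
  refine DistDescribedAtRatZero.real (γ := fun h : ℝ => f (x + h • ν)) hrz ?_
  filter_upwards [(hΩ.preimage (continuous_line x ν)).mem_nhds (x := (0 : ℝ)) (by simpa using hxΩ)]
    with t ht using hxl.continuousAt hΩ ht

end Lines

/-! ### The main theorem -/

theorem mainTheorem2 {n : ℕ} {X : Type*} [MetricSpace X] [CompleteSpace X]
    [MeasurableSpace X] [BorelSpace X] (z₀ : X)
    (Ω : Set (EuclideanSpace ℝ (Fin n))) (hΩ : IsOpen Ω)
    (ν : EuclideanSpace ℝ (Fin n)) (hν : ν ≠ 0)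
    (f : EuclideanSpace ℝ (Fin n) → X)
    (hf_meas : NullMeasurable f (volume.restrict Ω))
    (hf_sep : EssSeparablyValued f Ω)
    (hf_ac : ACOnAlmostEveryLine f Ω ν)
    (hf_int : LocallyIntegrableOn (metricDirDeriv f ν) Ω volume) :
    (∀ (Φ : BanachLimit) (δ : ℕ → ℝ) (hpos : ∀ k, 0 < δ k) (hlim : Tendsto δ atTop (𝓝 0)),
      (∀ᵐ x ∂volume.restrict Ω,
        IsWeakWeakStarDirDeriv f ν x (weakWeakStarDirDeriv Φ hpos hlim z₀ f ν x) ∧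
        HasMetricDirDeriv f ν x ‖weakWeakStarDirDeriv Φ hpos hlim z₀ f ν x‖) ∧
      NullMeasurable (fun x => ‖weakWeakStarDirDeriv Φ hpos hlim z₀ f ν x‖)
        (volume.restrict Ω)) ∧
    (∀ D : EuclideanSpace ℝ (Fin n) → StrongDual ℝ (LipZero X z₀),
      (∀ᵐ x ∂volume.restrict Ω, IsWeakWeakStarDirDeriv f ν x (D x)) →
      (∀ᵐ x ∂volume.restrict Ω, HasMetricDirDeriv f ν x ‖D x‖) ∧
      NullMeasurable (fun x => ‖D x‖) (volume.restrict Ω)) := by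
  have : Nonempty X := ⟨z₀⟩
  obtain ⟨d, hd⟩ := hf_sep.exists_dense_seq
  have hdesc : ∀ᵐ x ∂volume.restrict Ω, DistDescribedAtZero d fun h : ℝ => f (x + h • ν) :=
    (ae_restrict_iff' hΩ.measurableSet).2 (hf_ac.ae_distDescribedAtZero hΩ hf_meas hd)
  have hD : ∀ D : EuclideanSpace ℝ (Fin n) → StrongDual ℝ (LipZero X z₀),
      (∀ᵐ x ∂volume.restrict Ω, IsWeakWeakStarDirDeriv f ν x (D x)) →
      (∀ᵐ x ∂volume.restrict Ω, HasMetricDirDeriv f ν x ‖D x‖) ∧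
      NullMeasurable (fun x => ‖D x‖) (volume.restrict Ω) := by
    intro D hD
    have hm : ∀ᵐ x ∂volume.restrict Ω, HasMetricDirDeriv f ν x ‖D x‖ := by
      filter_upwards [hD, hdesc] with x hx hx' using hx.hasMetricDirDeriv_norm hx'
    refine ⟨hm, ?_⟩
    -- The norm agrees almost everywhere with `metricDirDeriv f ν`, whose measurability is part of
    -- local integrability.
    refine (hf_int.aestronglyMeasurable.aemeasurable.congr ?_).nullMeasurable
    filter_upwards [hm] with x hx using hx.metricDirDeriv_eq
  refine ⟨fun Φ δ hpos hlim => ?_, hD⟩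
  have hw : ∀ᵐ x ∂volume.restrict Ω,
      IsWeakWeakStarDirDeriv f ν x (weakWeakStarDirDeriv Φ hpos hlim z₀ f ν x) := by
    filter_upwards [hdesc] with x hx
    obtain ⟨c, -, hm⟩ := hx.exists_hasMetricDirDeriv
    exact isWeakWeakStarDirDeriv_weakWeakStarDirDeriv Φ hpos hlim hm.exists_dirLipBound
  obtain ⟨h1, h2⟩ := hD _ hw
  exact ⟨hw.and h1, h2⟩
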